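/- **Proposition (Strategy complexity for finitary Büchi games).** An *arena* is a countable (possibly infinite) directed graph $(V,E)$ in which every vertex has an outgoing edge, with a partition $V=V_E\sqcup V_A$ into Eve's and Adam's vertices. A *play* is an infinite path $\pi=\pi_0\pi_1\cdots$. For $F\subseteq V$ let $\mathrm{dist}_k(\pi,F)=\inf\{k'-k \mid k'\ge k,\ \pi_{k'}\in F\}\in\mathbb N\cup\{\infty\}$. In the *finitary Büchi game* given by an arena and $F$, Eve wins the plays in $$\mathrm{FinB\ddot uchi}(F)=\{\pi \mid \limsup_{k}\,\mathrm{dist}_k(\pi,F)<\infty\}$$ and Adam wins all other plays. A strategy of a player maps a finite history $w\in V^*$ and a current vertex $v$ of that player to a successor of $v$. It is winning from $U\subseteq V$ if, for every initial vertex in $U$ and every strategy of the opponent, the resulting play is won by the player. The *winning set* of a player is the set of vertices $v$ such that the player has a winning strategy from $\{v\}$. A strategy is *positional* if its move depends only on the current vertex. It has *finite memory* if there are a finite set $M$, an initial state $m_0\in M$, an update function $\mu:M\times E\to M$ reading the edges taken, and a next-move function $\nu$, such that the move is always $\nu(v,m)$, where $v$ is the current vertex and $m$ the current memory state. A *pushdown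 arena* is given by a finite set $Q$ of control states partitioned into $Q_E$ and $Q_A$, a finite stack alphabet $\Gamma$ with a bottom symbol $\bot\notin\Gamma$, and a set of transitions that push a symbol $b\in\Gamma$ (depending on the top symbol in $\Gamma\cup\{\bot\}$), pop a top symbol $a\in\Gamma$, or leave the stack unchanged (depending on the top symbol). Its vertices are the configurations $(q,u\bot)$ with $q\in Q$, $u\in\Gamma^*$; its edges are given by the transitions; a configuration belongs to Eve iff its control state is in $Q_E$; every configuration is required to have an outgoing edge. The following hold. 1. In every finitary Büchi game, Eve has a positional strategy that is winning from her (whole) winning set. 2. In general, winning strategies for Adam require infinite memory, even on pushdown arenas: there are a pushdown arena, a set $F_0\subseteq Q$ of control states, and a configuration $v_0$ such that, in the finitary Büchi game with $F=\{(q,u\bot)\mid q\in F_0\}$, Adam has a winning strategy from $v_0$, but no strategy of Adam that is winning from $v_0$ has finite memory. -/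

import Mathlib

namespace InfGame

/-- The two players. -/
inductive Player where
  | eve
  | adam

/-- An arena on the vertex set `V`: a directed graph without dead ends, together with a
partition of the vertices into Eve's vertices and Adam's vertices, given by `owner`. -/
structure Arena (V : Type*) where
  owner : V → Player
  E : V → V → Prop
  noDeadEnd : ∀ v, ∃ v', E v v'

variable {V : Type*}

/-- The set of vertices controlled by a player. -/
def Arena.vertices (A : Arena V) (P : Player) : Set V := {v | A.owner v = P}

/-- The set `Π` of all plays: the infinite paths of the arena. -/
def Arena.plays (A : Arena V) : Set (ℕ → V) := {π | ∀ n, A.E (π n) (π (n + 1))}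

/-- A strategy of the player `P`: from a finite history `w` and a current vertex `v` that belongs
to `P`, it prescribes a legal move. -/
structure Strategy (A : Arena V) (P : Player) where
  next : List V → A.vertices P → V
  legal : ∀ (w : List V) (v : A.vertices P), A.E v (next w v)

/-- The move made after the history `w` at the vertex `v`, by the player who controls `v`. -/
def jointMove {A : Arena V} (σ : Strategy A .eve) (τ : Strategy A .adam) (w : List V) (v : V) : V :=
  match h : A.owner v with
  | .eve => σ.next w ⟨v, h⟩
  | .adam => τ.next w ⟨v, h⟩

/-- History (oldest vertex first, current vertex excluded) and current vertex after `n` moves. -/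
def playState {A : Arena V} (v₀ : V) (σ : Strategy A .eve) (τ : Strategy A .adam) :
    ℕ → List V × V
  | 0 => ([], v₀)
  | n + 1 =>
    let s := playState v₀ σ τ n
    (s.1 ++ [s.2], jointMove σ τ s.1 s.2)

/-- The play `π(v₀, σ, τ)`. -/
def play {A : Arena V} (v₀ : V) (σ : Strategy A .eve) (τ : Strategy A .adam) : ℕ → V :=
  fun n => (playState v₀ σ τ n).2

/-- Eve's strategy `σ` is winning from the set `U` for the condition `Ω`. -/
def Strategy.EveWinsFrom {A : Arena V} (σ : Strategy A .eve) (U : Set V) (Ω : Set (ℕ → V)) : Prop :=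
  ∀ v₀ ∈ U, ∀ τ : Strategy A .adam, play v₀ σ τ ∈ Ω

/-- Adam's strategy `τ` is winning from the set `U` in the game where Eve's condition is `Ω`;
Adam's own condition is `Π \ Ω`. -/
def Strategy.AdamWinsFrom {A : Arena V} (τ : Strategy A .adam) (U : Set V) (Ω : Set (ℕ → V)) :
    Prop :=
  ∀ v₀ ∈ U, ∀ σ : Strategy A .eve, play v₀ σ τ ∈ A.plays \ Ω

/-- Eve's winning set `W_E(A, Ω)`. -/
def Arena.eveWinningSet (A : Arena V) (Ω : Set (ℕ → V)) : Set V :=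
  {v | ∃ σ : Strategy A .eve, σ.EveWinsFrom {v} Ω}

/-- Adam's winning set `W_A(A, Ω)`. -/
def Arena.adamWinningSet (A : Arena V) (Ω : Set (ℕ → V)) : Set V :=
  {v | ∃ τ : Strategy A .adam, τ.AdamWinsFrom {v} Ω}

/-- A strategy is positional if the move depends on the current vertex only. -/
def Strategy.IsPositional {A : Arena V} {P : Player} (σ : Strategy A P) : Prop :=
  ∃ f : A.vertices P → V, ∀ w v, σ.next w v = f v

/-- A memory structure with set of memory states `M`. The update function reads the edge that is
taken; its values on pairs of vertices that are not edges are irrelevant to plays. -/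
structure MemoryStructure (V : Type*) (M : Type*) where
  init : M
  update : M → V × V → M

/-- The memory state reached from `m` by reading the consecutive edges of a finite path. -/
def MemoryStructure.run {M : Type*} (𝓜 : MemoryStructure V M) : M → List V → M
  | m, u :: v :: w => 𝓜.run (𝓜.update m (u, v)) (v :: w)
  | m, _ => m

/-- The strategy relies on the memory structure `𝓜`: its moves are given by a next-move function
of the current vertex and the current memory state. -/
def Strategy.ReliesOn {A : Arena V} {P : Player} {M : Type*} (σ : Strategy A P)
    (𝓜 : MemoryStructure V M) : Prop :=
  ∃ ν : A.vertices P → M → V, ∀ w v, σ.next w v = ν v (𝓜.run 𝓜.init (w ++ [(v : V)]))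

/-- The strategy relies on some memory structure with finitely many memory states. -/
def Strategy.HasFiniteMemory {A : Arena V} {P : Player} (σ : Strategy A P) : Prop :=
  ∃ (M : Type) (_ : Finite M) (𝓜 : MemoryStructure V M), σ.ReliesOn 𝓜

/-- `dist_k(π, F)`: number of steps from position `k` to the next visit of `F` (`⊤` if none). -/
noncomputable def buchiDist (π : ℕ → V) (F : Set V) (k : ℕ) : ℕ∞ :=
  sInf {d | ∃ k', k ≤ k' ∧ π k' ∈ F ∧ d = ((k' - k : ℕ) : ℕ∞)}

/-- The finitary Büchi condition: the plays along which the distances to the next visit of `F`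
have a finite limit superior. -/
def Arena.finBuchi (A : Arena V) (F : Set V) : Set (ℕ → V) :=
  {π | π ∈ A.plays ∧ Filter.limsup (buchiDist π F) Filter.atTop < ⊤}

/-- Transitions of a pushdown process with control states `Q` and stack alphabet `Γ`. A top symbol
in `Γ ∪ {⊥}` is an element of `Option Γ`, where `none` is the bottom symbol `⊥`. -/
inductive PDTransition (Q Γ : Type*) where
  | push (p : Q) (a : Option Γ) (b : Γ) (q : Q)
  | pop (p : Q) (a : Γ) (q : Q)
  | skip (p : Q) (a : Option Γ) (q : Q)

/-- A pushdown process with finitely many control states and stack symbols. -/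
structure PushdownProcess (Q Γ : Type*) where
  finiteStates : Finite Q
  finiteAlphabet : Finite Γ
  Δ : Set (PDTransition Q Γ)

/-- The edges between configurations. The configuration `(q, u⊥)` is the pair `(q, u)`, with the
top of the stack at the head of `u`; so `u.head?` is the top symbol, and is `none` for `⊥`. -/
inductive PushdownProcess.Step {Q Γ : Type*} (S : PushdownProcess Q Γ) :
    Q × List Γ → Q × List Γ → Prop
  | push {p q : Q} {b : Γ} {u : List Γ} (h : PDTransition.push p u.head? b q ∈ S.Δ) :
      S.Step (p, u) (q, b :: u)
  | pop {p q : Q} {a : Γ} {u : List Γ} (h : PDTransition.pop p a q ∈ S.Δ) :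
      S.Step (p, a :: u) (q, u)
  | skip {p q : Q} {u : List Γ} (h : PDTransition.skip p u.head? q ∈ S.Δ) :
      S.Step (p, u) (q, u)

/-- The pushdown arena of a pushdown process without dead ends, where the control states are
partitioned between the players by `owner`. -/
def PushdownProcess.arena {Q Γ : Type*} (S : PushdownProcess Q Γ) (owner : Q → Player)
    (h : ∀ c, ∃ c', S.Step c c') : Arena (Q × List Γ) where
  owner c := owner c.1
  E := S.Step
  noDeadEnd := h

end InfGame

namespace InfGame

/-! ### Plays and strategies -/

section Plays

variable {V : Type*} {A : Arena V}

/-! The limsup is finite iff, from some position on, the gaps between visits of `F` are bounded, a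
condition inherited from any tail of the play. For Eve, call a set a region if one positional
strategy keeps the play inside it and bounds the gaps. Well-order all regions and play, at each
vertex, the strategy of the least region containing it: the region used never increases, so it is
eventually constant. The union of all regions is therefore a region `X`. By `Arena.IsRegion.extend`,
`X` absorbs every `Y` from which Eve can force, within a uniform number of moves, either `X` or a
visit of `F` followed by a return to `Y`. By this closure property, outside `X` Adam can beat any
strategy of Eve by stringing together ever longer stretches without `F` (`Strategy.exists_gap`,
`Strategy.exists_unbounded_play`). So `X` contains Eve's winning set. For Adam, a stack serves as a
clock: climbing costs nothing, but emptying it keeps the play outside `F`. He wins with ever higher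
climbs, whereas finite memory makes the play eventually periodic or eventually confined to `F`. -/

theorem jointMove_eve (σ : Strategy A .eve) (τ : Strategy A .adam) (w : List V) {v : V}
    (h : A.owner v = .eve) : jointMove σ τ w v = σ.next w ⟨v, h⟩ := by
  unfold jointMove
  split
  · rfl
  · next h' => rw [h] at h'; cases h'

theorem jointMove_adam (σ : Strategy A .eve) (τ : Strategy A .adam) (w : List V) {v : V}
    (h : A.owner v = .adam) : jointMove σ τ w v = τ.next w ⟨v, h⟩ := by
  unfold jointMove
  split
  · next h' => rw [h] at h'; cases h'
  · rfl

theorem jointMove_legal (σ : Strategy A .eve) (τ : Strategy A .adam) (w : List V) (v : V) :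
    A.E v (jointMove σ τ w v) := by
  unfold jointMove
  split
  · next h => exact σ.legal w ⟨v, h⟩
  · next h => exact τ.legal w ⟨v, h⟩

theorem playState_eq {σ : Strategy A .eve} {τ : Strategy A .adam} {π : ℕ → V}
    (h : ∀ n, π (n + 1) = jointMove σ τ ((List.range n).map π) (π n)) (n : ℕ) :
    playState (π 0) σ τ n = ((List.range n).map π, π n) := by
  induction n with
  | zero => rfl
  | succ n ih => simp [playState, ih, List.range_succ, h n]

theorem playState_fst (v : V) (σ : Strategy A .eve) (τ : Strategy A .adam) (n : ℕ) :
    (playState v σ τ n).1 = (List.range n).map (play v σ τ) := by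
  induction n with
  | zero => rfl
  | succ n ih => simp [playState, ih, List.range_succ, play]

theorem play_succ (v : V) (σ : Strategy A .eve) (τ : Strategy A .adam) (n : ℕ) :
    play v σ τ (n + 1) =
      jointMove σ τ ((List.range n).map (play v σ τ)) (play v σ τ n) := by
  rw [← playState_fst]; rfl

theorem play_mem_plays (v : V) (σ : Strategy A .eve) (τ : Strategy A .adam) :
    play v σ τ ∈ A.plays := fun n => by
  rw [play_succ]; exact jointMove_legal _ _ _ _

theorem exists_strategy (A : Arena V) (P : Player) : Nonempty (Strategy A P) :=
  ⟨⟨fun _ v => (A.noDeadEnd v).choose, fun _ v => (A.noDeadEnd v).choose_spec⟩⟩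

/-- Every path that agrees with Eve's strategy is the play against some strategy of Adam. -/
theorem exists_adam_play_eq (σ : Strategy A .eve) {π : ℕ → V} (hπ : π ∈ A.plays)
    (hσ : ∀ n (h : A.owner (π n) = .eve),
      π (n + 1) = σ.next ((List.range n).map π) ⟨π n, h⟩) :
    ∃ τ : Strategy A .adam, play (π 0) σ τ = π := by
  classical
  let τ : Strategy A .adam :=
    -- The length of the history is the current time, so Adam can copy `π`; the default only ensures
    -- legality off `π`.
    { next := fun w v => if A.E v (π (w.length + 1)) then π (w.length + 1)
        else (A.noDeadEnd v).choose
      legal := fun w v => by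
        split_ifs with h
        · exact h
        · exact (A.noDeadEnd v).choose_spec }
  refine ⟨τ, funext fun n => ?_⟩
  unfold play
  rw [playState_eq]
  intro n
  cases h : A.owner (π n) with
  | eve => rw [jointMove_eve _ _ _ h]; exact hσ n h
  | adam =>
    rw [jointMove_adam _ _ _ h]
    simp [τ, hπ n]

end Plays

/-! ### The finitary Büchi condition in terms of bounded gaps -/

/-- From some position on, the distance to the next visit of `F` is bounded. -/
def BoundedGaps {V : Type*} (F : Set V) (π : ℕ → V) : Prop :=
  ∃ N K : ℕ, ∀ k, K ≤ k → ∃ k', k ≤ k' ∧ k' ≤ k + N ∧ π k' ∈ F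

section Gaps

variable {V : Type*} {F : Set V}

theorem buchiDist_le_iff {π : ℕ → V} {k N : ℕ} :
    buchiDist π F k ≤ N ↔ ∃ k', k ≤ k' ∧ k' ≤ k + N ∧ π k' ∈ F := by
  constructor
  · intro h
    have hne : {d : ℕ∞ | ∃ k', k ≤ k' ∧ π k' ∈ F ∧ d = ((k' - k : ℕ) : ℕ∞)}.Nonempty := by
      by_contra hne
      rw [Set.not_nonempty_iff_eq_empty] at hne
      rw [buchiDist, hne, sInf_empty] at h
      exact absurd h (by simp)
    obtain ⟨k', hk, hF, hd⟩ := csInf_mem hne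
    refine ⟨k', hk, ?_, hF⟩
    have h' : ((k' - k : ℕ) : ℕ∞) ≤ N := hd ▸ h
    have := Nat.cast_le.mp h'
    omega
  · rintro ⟨k', hk, hN, hF⟩
    have hmem : ((k' - k : ℕ) : ℕ∞) ∈
        {d : ℕ∞ | ∃ k', k ≤ k' ∧ π k' ∈ F ∧ d = ((k' - k : ℕ) : ℕ∞)} := ⟨k', hk, hF, rfl⟩
    exact (sInf_le hmem).trans (Nat.cast_le.mpr (by omega))

theorem limsup_buchiDist_lt_top_iff {π : ℕ → V} :
    Filter.limsup (buchiDist π F) Filter.atTop < ⊤ ↔ BoundedGaps F π := by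
  constructor
  · intro h
    obtain ⟨N, hN⟩ := ENat.ne_top_iff_exists.mp h.ne
    -- Only a strict bound on the limsup gives an eventual bound, hence `N + 1`.
    have hlt : Filter.limsup (buchiDist π F) Filter.atTop < ((N + 1 : ℕ) : ℕ∞) := by
      rw [← hN]; exact Nat.cast_lt.mpr (Nat.lt_succ_self N)
    obtain ⟨K, hK⟩ := Filter.eventually_atTop.mp (Filter.eventually_lt_of_limsup_lt hlt)
    exact ⟨N + 1, K, fun k hk => buchiDist_le_iff.mp (hK k hk).le⟩
  · rintro ⟨N, K, h⟩
    refine lt_of_le_of_lt (b := (N : ℕ∞)) ?_ (ENat.natCast_lt_top N)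
    exact Filter.limsup_le_of_le (by isBoundedDefault)
      (Filter.eventually_atTop.mpr ⟨K, fun k hk => buchiDist_le_iff.mpr (h k hk)⟩)

theorem mem_finBuchi_iff {A : Arena V} {π : ℕ → V} :
    π ∈ A.finBuchi F ↔ π ∈ A.plays ∧ BoundedGaps F π :=
  and_congr_right fun _ => limsup_buchiDist_lt_top_iff

theorem BoundedGaps.of_shift {π : ℕ → V} {m : ℕ} (h : BoundedGaps F fun n => π (m + n)) :
    BoundedGaps F π := by
  obtain ⟨N, K, h⟩ := h
  refine ⟨N, m + K, fun k hk => ?_⟩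
  obtain ⟨k', h1, h2, h3⟩ := h (k - m) (by omega)
  exact ⟨m + k', by omega, by omega, h3⟩

end Gaps

/-! ### Regions in which Eve wins positionally -/

section Regions

variable {V : Type*} {A : Arena V} {F : Set V}

/-- The vertices from which Eve can force the next vertex to be in `Y`. -/
def Arena.cpre (A : Arena V) (Y : Set V) : Set V :=
  {v | (A.owner v = .eve → ∃ v', A.E v v' ∧ v' ∈ Y) ∧
    (A.owner v = .adam → ∀ v', A.E v v' → v' ∈ Y)}

theorem Arena.cpre_mono {Y Z : Set V} (h : Y ⊆ Z) : A.cpre Y ⊆ A.cpre Z :=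
  fun _ hv => ⟨fun he => (hv.1 he).imp fun _ hv' => ⟨hv'.1, h hv'.2⟩,
    fun ha v' hE => h (hv.2 ha v' hE)⟩

/-- The vertices from which Eve can force a visit of `T` within `n` moves. -/
def Arena.attr (A : Arena V) (T : Set V) : ℕ → Set V
  | 0 => T
  | n + 1 => T ∪ A.cpre (A.attr T n)

theorem Arena.subset_attr (T : Set V) : ∀ n, T ⊆ A.attr T n
  | 0 => subset_rfl
  | _ + 1 => Set.subset_union_left

theorem Arena.attr_mono (T : Set V) : Monotone (A.attr T) := by
  refine monotone_nat_of_le_succ fun n => ?_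
  induction n with
  | zero => exact A.subset_attr T 1
  | succ n ih => exact Set.union_subset_union_right _ (Arena.cpre_mono ih)

/-- The path `π` follows Eve's positional strategy `f`. -/
def Arena.Follows (A : Arena V) (f : V → V) (π : ℕ → V) : Prop :=
  π ∈ A.plays ∧ ∀ n, A.owner (π n) = .eve → π (n + 1) = f (π n)

theorem Arena.Follows.shift {f : V → V} {π : ℕ → V} (h : A.Follows f π) (m : ℕ) :
    A.Follows f fun n => π (m + n) :=
  ⟨fun n => h.1 (m + n), fun n => h.2 (m + n)⟩

/-- The positional strategy `f` keeps the play in `X` and ensures bounded gaps there. -/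
structure Arena.IsRegion (A : Arena V) (F X : Set V) (f : V → V) : Prop where
  eve : ∀ v ∈ X, A.owner v = .eve → A.E v (f v) ∧ f v ∈ X
  adam : ∀ v ∈ X, A.owner v = .adam → ∀ v', A.E v v' → v' ∈ X
  gaps : ∀ π, A.Follows f π → π 0 ∈ X → BoundedGaps F π

theorem Arena.IsRegion.step_mem {X : Set V} {f : V → V} (h : A.IsRegion F X f) {v v' : V}
    (hv : v ∈ X) (hE : A.E v v') (hf : A.owner v = .eve → v' = f v) : v' ∈ X := by
  cases ho : A.owner v with
  | eve => rw [hf ho]; exact (h.eve v hv ho).2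
  | adam => exact h.adam v hv ho v' hE

/-- There is a largest region. -/
theorem exists_greatest_region (A : Arena V) (F : Set V) :
    ∃ X f, A.IsRegion F X f ∧ ∀ Y g, A.IsRegion F Y g → Y ⊆ X := by
  classical
  let I := {p : Set V × (V → V) // A.IsRegion F p.1 p.2}
  obtain ⟨_, hwf⟩ := exists_wellFoundedLT I
  let X : Set V := {v | ∃ i : I, v ∈ i.1.1}
  have hex : ∀ v, ∃ i : I, v ∈ X → v ∈ i.1.1 ∧ ∀ j : I, v ∈ j.1.1 → i ≤ j := by
    intro v
    by_cases hv : v ∈ X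
    · have hne : {i : I | v ∈ i.1.1}.Nonempty := hv
      refine ⟨hwf.wf.min _ hne, fun _ => ⟨hwf.wf.min_mem _ hne, fun j hj => ?_⟩⟩
      exact not_lt.mp (hwf.wf.not_lt_min _ hj)
    -- Default index outside `X`: the empty region.
    · refine ⟨⟨(∅, id), ?_, ?_, ?_⟩, fun h => absurd h hv⟩
      · rintro _ ⟨⟩
      · rintro _ ⟨⟩
      · rintro _ _ ⟨⟩
  choose i hi using hex
  have hstep : ∀ v v', v ∈ X → A.E v v' → (A.owner v = .eve → v' = (i v).1.2 v) →
      v' ∈ (i v).1.1 := fun v v' hv hE hf => (i v).2.step_mem (hi v hv).1 hE hf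
  refine ⟨X, fun v => (i v).1.2 v, ⟨?_, ?_, ?_⟩, fun Y g h v hv => ⟨⟨(Y, g), h⟩, hv⟩⟩
  · intro v hv ho
    have := (i v).2.eve v (hi v hv).1 ho
    exact ⟨this.1, i v, this.2⟩
  · intro v hv ho v' hE
    exact ⟨i v, (i v).2.adam v (hi v hv).1 ho v' hE⟩
  · intro π hπ h0
    have hX : ∀ n, π n ∈ X := by
      intro n
      induction n with
      | zero => exact h0
      | succ n ih => exact ⟨i (π n), hstep _ _ ih (hπ.1 n) (hπ.2 n)⟩
    -- The least index met along the play is reached at some `K`; as indices never increase, it is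
    -- kept from then on.
    obtain ⟨_, ⟨K, rfl⟩, hK⟩ := hwf.wf.has_min (Set.range fun n => i (π n)) ⟨_, 0, rfl⟩
    have hconst : ∀ n, i (π (K + n)) = i (π K) := by
      intro n
      induction n with
      | zero => rfl
      | succ n ih =>
        refine le_antisymm ?_ (not_lt.mp (hK _ ⟨K + (n + 1), rfl⟩))
        rw [← ih]
        exact (hi _ (hX _)).2 _ (hstep _ _ (hX _) (hπ.1 _) (hπ.2 _))
    refine BoundedGaps.of_shift (m := K) ((i (π K)).2.gaps _ ?_ (hi _ (hX K)).1)
    refine ⟨(hπ.shift K).1, fun n ho => ?_⟩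
    rw [(hπ.shift K).2 n ho]
    simp only [hconst]

/-- A region extends to the vertices from which Eve can force, within `N` moves, a visit of the
region or a visit of `F` from which she can force a return. -/
theorem Arena.IsRegion.extend {X : Set V} {f : V → V} (h : A.IsRegion F X f) {N : ℕ} {Y : Set V}
    (hY : Y ⊆ A.attr (X ∪ (F ∩ A.cpre Y)) N) :
    ∃ g, A.IsRegion F (A.attr (X ∪ (F ∩ A.cpre Y)) N) g := by
  classical
  set T := X ∪ (F ∩ A.cpre Y) with hT
  set Z := A.attr T N with hZ
  have hTZ : T ⊆ Z := A.subset_attr T N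
  have hXZ : X ⊆ Z := Set.subset_union_left.trans hTZ
  -- A good move stays in `Z` and, outside `T`, descends one attractor level; quantifying over all
  -- levels makes the choice independent of the history.
  let Good : V → V → Prop := fun v v' =>
    v' ∈ Z ∧ (v ∉ T → ∀ n, v ∈ A.attr T (n + 1) → v' ∈ A.attr T n)
  have hgood : ∀ v ∈ Z, v ∉ X → v ∈ A.cpre {v' | Good v v'} := by
    intro v hv hvX
    by_cases hvT : v ∈ T
    · have : v ∈ A.cpre Y := (hvT.resolve_left hvX).2
      exact Arena.cpre_mono (Z := {v' | Good v v'}) (fun v' hv' => ⟨hY hv', fun h => absurd hvT h⟩) this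
    · have hex : ∃ n, v ∈ A.attr T n := ⟨N, hv⟩
      obtain ⟨r, hr⟩ : ∃ r, Nat.find hex = r + 1 := by
        refine Nat.exists_eq_succ_of_ne_zero fun h0 => hvT ?_
        have := Nat.find_spec hex
        rwa [h0] at this
      have hmem : v ∈ A.attr T (r + 1) := hr ▸ Nat.find_spec hex
      have hle : ∀ n, v ∈ A.attr T n → r + 1 ≤ n := fun n hn => hr ▸ Nat.find_min' hex hn
      refine Arena.cpre_mono (Z := {v' | Good v v'}) (fun v' hv' => ⟨?_, fun _ n hn => ?_⟩)
        (hmem.resolve_left hvT)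
      · exact A.attr_mono T (Nat.le_of_succ_le (hle N hv)) hv'
      · exact A.attr_mono T (Nat.le_of_succ_le_succ (hle _ hn)) hv'
  have hchoice : ∀ v, ∃ v', (v ∈ X → v' = f v) ∧
      (v ∈ Z → v ∉ X → A.owner v = .eve → A.E v v' ∧ Good v v') := by
    intro v
    by_cases hvX : v ∈ X
    · exact ⟨f v, fun _ => rfl, fun _ h => absurd hvX h⟩
    · by_cases hv : v ∈ Z ∧ A.owner v = .eve
      · obtain ⟨v', hv'⟩ := (hgood v hv.1 hvX).1 hv.2
        exact ⟨v', fun h => absurd h hvX, fun _ _ _ => hv'⟩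
      · exact ⟨v, fun h => absurd h hvX, fun h1 _ h2 => absurd ⟨h1, h2⟩ hv⟩
  choose g hgX hgZ using hchoice
  refine ⟨g, ⟨fun v hv ho => ?_, fun v hv ho v' hE => ?_, fun π hπ h0 => ?_⟩⟩
  · by_cases hvX : v ∈ X
    · rw [hgX v hvX]
      exact ⟨(h.eve v hvX ho).1, hXZ (h.eve v hvX ho).2⟩
    · exact ⟨(hgZ v hv hvX ho).1, (hgZ v hv hvX ho).2.1⟩
  · by_cases hvX : v ∈ X
    · exact hXZ (h.adam v hvX ho v' hE)
    · exact ((hgood v hv hvX).2 ho v' hE).1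
  -- Once in `X`, the play follows `f` forever. If it never enters `X`, every visit of `T` is a
  -- visit of `F`, and the descent reaches one within `N` moves.
  · by_cases hK : ∃ K, π K ∈ X
    · obtain ⟨K, hK⟩ := hK
      have hX : ∀ n, π (K + n) ∈ X := by
        intro n
        induction n with
        | zero => exact hK
        | succ n ih =>
          exact h.step_mem ih (hπ.1 _) fun ho => (hπ.2 _ ho).trans (hgX _ ih)
      exact BoundedGaps.of_shift (m := K)
        (h.gaps _ ⟨(hπ.shift K).1, fun n ho => (hπ.2 _ ho).trans (hgX _ (hX n))⟩ hK)
    · push Not at hK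
      have hstep : ∀ n, π n ∈ Z → Good (π n) (π (n + 1)) := by
        intro n hn
        cases ho : A.owner (π n) with
        | eve => rw [hπ.2 n ho]; exact (hgZ _ hn (hK n) ho).2
        | adam => exact (hgood _ hn (hK n)).2 ho _ (hπ.1 n)
      have hZn : ∀ n, π n ∈ Z := by
        intro n
        induction n with
        | zero => exact h0
        | succ n ih => exact (hstep n ih).1
      have hvisit : ∀ n k, π k ∈ A.attr T n → ∃ k', k ≤ k' ∧ k' ≤ k + n ∧ π k' ∈ F := by
        intro n
        induction n with
        | zero => exact fun k hk => ⟨k, le_rfl, le_rfl, (hk.resolve_left (hK k)).1⟩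
        | succ n ih =>
          intro k hk
          by_cases hkT : π k ∈ T
          · exact ⟨k, le_rfl, by omega, (hkT.resolve_left (hK k)).1⟩
          · obtain ⟨k', h1, h2, h3⟩ := ih (k + 1) ((hstep k (hZn k)).2 hkT n hk)
            exact ⟨k', by omega, by omega, h3⟩
      exact ⟨N, 0, fun k _ => hvisit N k (hZn k)⟩

end Regions

/-! ### Outside the greatest region Eve's strategies are not winning -/

section Outside

variable {V : Type*} {A : Arena V} {F : Set V}

/-- The first `n` moves of `π` form a path from `v` that avoids `X` and follows `σ`. -/
structure Strategy.IsPrefix (σ : Strategy A .eve) (X : Set V) (v : V) (π : ℕ → V) (n : ℕ) :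
    Prop where
  start : π 0 = v
  avoid : ∀ i ≤ n, π i ∉ X
  edge : ∀ i < n, A.E (π i) (π (i + 1))
  move : ∀ i < n, ∀ h : A.owner (π i) = .eve,
    π (i + 1) = σ.next ((List.range i).map π) ⟨π i, h⟩

theorem Strategy.next_congr {P : Player} (σ : Strategy A P) {w w' : List V}
    {v v' : A.vertices P} (hw : w = w') (hv : (v : V) = v') : σ.next w v = σ.next w' v' := by
  rw [hw, Subtype.ext hv]

theorem map_range_congr {π π' : ℕ → V} {i : ℕ} (h : ∀ j < i, π j = π' j) :
    (List.range i).map π = (List.range i).map π' :=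
  List.map_congr_left fun j hj => h j (List.mem_range.mp hj)

/-- Finite paths are carried by total sequences whose values past `n` are irrelevant, so a prefix
can be transferred to a limit sequence. -/
theorem Strategy.IsPrefix.congr {σ : Strategy A .eve} {X : Set V} {v : V} {π π' : ℕ → V} {n : ℕ}
    (h : σ.IsPrefix X v π n) (hπ : ∀ i ≤ n, π' i = π i) : σ.IsPrefix X v π' n where
  start := by rw [hπ 0 (Nat.zero_le n)]; exact h.start
  avoid i hi := by rw [hπ i hi]; exact h.avoid i hi
  edge i hi := by rw [hπ i hi.le, hπ (i + 1) hi]; exact h.edge i hi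
  move i hi ho := by
    rw [hπ (i + 1) hi, h.move i hi (by rw [← hπ i hi.le]; exact ho)]
    exact σ.next_congr (map_range_congr fun j hj => (hπ j (by omega)).symm) (hπ i hi.le).symm

theorem Strategy.IsPrefix.extend {σ : Strategy A .eve} {X : Set V} {v : V} {π : ℕ → V} {n : ℕ}
    (h : σ.IsPrefix X v π n) {v' : V} (hE : A.E (π n) v')
    (hσ : ∀ ho : A.owner (π n) = .eve, v' = σ.next ((List.range n).map π) ⟨π n, ho⟩)
    (hX : v' ∉ X) :
    ∃ π', σ.IsPrefix X v π' (n + 1) ∧ (∀ i ≤ n, π' i = π i) ∧ π' (n + 1) = v' := by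
  classical
  have hag : ∀ i ≤ n, Function.update π (n + 1) v' i = π i := fun i hi =>
    Function.update_of_ne (by omega) _ _
  have hlast : Function.update π (n + 1) v' (n + 1) = v' := Function.update_self _ _ _
  refine ⟨Function.update π (n + 1) v', ?_, hag, hlast⟩
  have h' := h.congr hag
  refine ⟨h'.start, fun i hi => ?_, fun i hi => ?_, fun i hi ho => ?_⟩
  · rcases Nat.lt_or_ge n i with hi' | hi'
    · obtain rfl : i = n + 1 := by omega
      rwa [hlast]
    · exact h'.avoid i hi'
  · rcases Nat.lt_or_ge i n with hi' | hi'
    · exact h'.edge i hi'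
    · obtain rfl : i = n := by omega
      rwa [hlast, hag i le_rfl]
  · rcases Nat.lt_or_ge i n with hi' | hi'
    · exact h'.move i hi' ho
    · obtain rfl : i = n := by omega
      exact hlast.trans ((hσ (by rw [← hag i le_rfl]; exact ho)).trans
        (σ.next_congr (map_range_congr fun j hj => (hag j hj.le).symm) (hag i le_rfl).symm))

/-- Let `Y` be `X` together with the ends of all prolongations of the prefix that follow `σ` and
avoid `X`. If none of them ended in a stretch of `N` moves without `F`, Eve could force `T` within
`N` moves from everywhere in `Y`; then `Y ⊆ X` by `hX`, although the given prefix ends outside `X`.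
-/
theorem Strategy.IsPrefix.exists_gap {σ : Strategy A .eve} {X : Set V} {v : V}
    (hX : ∀ N Y, Y ⊆ A.attr (X ∪ (F ∩ A.cpre Y)) N → Y ⊆ X) {π : ℕ → V} {n : ℕ}
    (h : σ.IsPrefix X v π n) (N : ℕ) :
    ∃ π' n', σ.IsPrefix X v π' n' ∧ (∀ i ≤ n, π' i = π i) ∧
      ∃ k, n ≤ k ∧ k + N = n' ∧ ∀ i ≤ N, π' (k + i) ∉ F := by
  by_contra hcon
  push Not at hcon
  let Y : Set V := X ∪ {y | ∃ π' n', n ≤ n' ∧ σ.IsPrefix X v π' n' ∧ (∀ i ≤ n, π' i = π i) ∧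
    π' n' = y}
  set T := X ∪ (F ∩ A.cpre Y) with hT
  have hXT : X ⊆ T := Set.subset_union_left
  -- A move allowed by `σ` either enters `X` or prolongs the prefix; both lead to `Y`. Hence an end
  -- in `F` lies in `T`.
  have hcpre : ∀ π' n', n ≤ n' → σ.IsPrefix X v π' n' → (∀ i ≤ n, π' i = π i) →
      π' n' ∈ A.cpre Y := by
    intro π' n' hn hp hag
    have key : ∀ v', A.E (π' n') v' →
        (∀ ho : A.owner (π' n') = .eve, v' = σ.next ((List.range n').map π') ⟨π' n', ho⟩) →
        v' ∈ Y := by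
      intro v' hE hσ
      by_cases hv' : v' ∈ X
      · exact Or.inl hv'
      · obtain ⟨π'', hp', hag', hl⟩ := hp.extend hE hσ hv'
        exact Or.inr ⟨π'', n' + 1, by omega, hp',
          fun i hi => (hag' i (by omega)).trans (hag i hi), hl⟩
    exact ⟨fun ho => ⟨_, σ.legal _ ⟨π' n', ho⟩, key _ (σ.legal _ ⟨π' n', ho⟩) fun _ => rfl⟩,
      fun ho v' hE => key v' hE fun ho' => by rw [ho] at ho'; cases ho'⟩
  have hrun : ∀ m π' n', n ≤ n' → σ.IsPrefix X v π' n' → (∀ i ≤ n, π' i = π i) →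
      π' n' ∉ A.attr T m → ∃ π'', σ.IsPrefix X v π'' (n' + m) ∧ (∀ i ≤ n', π'' i = π' i) ∧
        ∀ i ≤ m, π'' (n' + i) ∉ F := by
    intro m
    induction m with
    | zero =>
      intro π' n' hn hp hag hm
      refine ⟨π', hp, fun _ _ => rfl, fun i hi hF => hm (Or.inr ?_)⟩
      obtain rfl : i = 0 := by omega
      exact ⟨hF, hcpre π' n' hn hp hag⟩
    | succ m ih =>
      intro π' n' hn hp hag hm
      have hF : π' n' ∉ F := fun hF => hm (Or.inl (Or.inr ⟨hF, hcpre π' n' hn hp hag⟩))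
      have hm' : π' n' ∉ A.cpre (A.attr T m) := fun h => hm (Or.inr h)
      obtain ⟨v', hE, hσ, hv'⟩ : ∃ v', A.E (π' n') v' ∧
          (∀ ho : A.owner (π' n') = .eve, v' = σ.next ((List.range n').map π') ⟨π' n', ho⟩) ∧
          v' ∉ A.attr T m := by
        by_contra hno
        push Not at hno
        exact hm' ⟨fun ho => ⟨_, σ.legal _ ⟨π' n', ho⟩,
          hno _ (σ.legal _ ⟨π' n', ho⟩) fun _ => rfl⟩,
          fun ho v' hE => hno v' hE fun ho' => by rw [ho] at ho'; cases ho'⟩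
      obtain ⟨π₁, hp₁, hag₁, hl₁⟩ := hp.extend hE hσ fun h => hv' (A.subset_attr T m (hXT h))
      obtain ⟨π₂, hp₂, hag₂, hF₂⟩ := ih π₁ (n' + 1) (by omega) hp₁
        (fun i hi => (hag₁ i (by omega)).trans (hag i hi)) (by rwa [hl₁])
      have hag₃ : ∀ i ≤ n', π₂ i = π' i := fun i hi =>
        (hag₂ i (by omega)).trans (hag₁ i hi)
      refine ⟨π₂, by rwa [show n' + (m + 1) = n' + 1 + m by omega], hag₃, fun i hi => ?_⟩
      cases i with
      | zero => rw [Nat.add_zero, hag₃ n' le_rfl]; exact hF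
      | succ i =>
        rw [show n' + (i + 1) = n' + 1 + i by omega]
        exact hF₂ i (by omega)
  have hsub : Y ⊆ A.attr T N := by
    rintro y (hy | ⟨π', n', hn, hp, hag, rfl⟩)
    · exact A.subset_attr T N (hXT hy)
    · by_contra hnot
      obtain ⟨π'', hp', hag', hF⟩ := hrun N π' n' hn hp hag hnot
      obtain ⟨i, hi, hiF⟩ := hcon π'' (n' + N) hp'
        (fun i hi => (hag' i (by omega)).trans (hag i hi)) n' hn rfl
      exact hF i hi hiF
  exact h.avoid n le_rfl (hX N Y hsub (Or.inr ⟨π, n, le_rfl, h, fun _ _ => rfl, rfl⟩))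

/-- Stage `j` appends a stretch of `j + 1` moves without `F`. The prefixes grow strictly and
converge to a play that follows `σ`. -/
theorem Strategy.exists_unbounded_play (σ : Strategy A .eve) {X : Set V} {v : V}
    (hX : ∀ N Y, Y ⊆ A.attr (X ∪ (F ∩ A.cpre Y)) N → Y ⊆ X) (hv : v ∉ X) :
    ∃ τ : Strategy A .adam, ¬ BoundedGaps F (play v σ τ) := by
  let S := {p : (ℕ → V) × ℕ // σ.IsPrefix X v p.1 p.2}
  have hnext : ∀ (N : ℕ) (s : S), ∃ s' : S, (∀ i ≤ s.1.2, s'.1.1 i = s.1.1 i) ∧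
      ∃ k, s.1.2 ≤ k ∧ k + (N + 1) = s'.1.2 ∧ ∀ i ≤ N + 1, s'.1.1 (k + i) ∉ F := by
    intro N s
    obtain ⟨π', n', hp, hag, hk⟩ := s.2.exists_gap hX (N + 1)
    exact ⟨⟨(π', n'), hp⟩, hag, hk⟩
  choose next hag hgap using hnext
  let s₀ : S := ⟨(fun _ => v, 0), rfl, fun _ _ => hv, fun _ h => absurd h (Nat.not_lt_zero _),
    fun _ h => absurd h (Nat.not_lt_zero _)⟩
  let s : ℕ → S := fun j => Nat.rec s₀ next j
  have hlen_succ : ∀ j, (s j).1.2 + 1 ≤ (s (j + 1)).1.2 := by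
    intro j
    obtain ⟨k, h1, h2, -⟩ := hgap j (s j)
    change _ ≤ (next j (s j)).1.2
    omega
  have hlen_mono : Monotone fun j => (s j).1.2 :=
    monotone_nat_of_le_succ fun j => Nat.le_of_succ_le (hlen_succ j)
  have hlen : ∀ j, j ≤ (s j).1.2 := by
    intro j
    induction j with
    | zero => exact Nat.zero_le _
    | succ j ih => exact (Nat.succ_le_succ ih).trans (hlen_succ j)
  have hagree : ∀ j d, ∀ i ≤ (s j).1.2, (s (j + d)).1.1 i = (s j).1.1 i := by
    intro j d
    induction d with
    | zero => exact fun _ _ => rfl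
    | succ d ih =>
      intro i hi
      exact (hag (j + d) (s (j + d)) i (hi.trans (hlen_mono (Nat.le_add_right j d)))).trans
        (ih i hi)
  -- Stage `i` has length at least `i`, so its value at `i` is final.
  let π : ℕ → V := fun i => (s i).1.1 i
  have hπ : ∀ j, ∀ i ≤ (s j).1.2, π i = (s j).1.1 i := by
    intro j i hi
    rcases le_total i j with hij | hij
    · obtain ⟨d, rfl⟩ := Nat.exists_eq_add_of_le hij
      exact (hagree i d i (hlen i)).symm
    · obtain ⟨d, rfl⟩ := Nat.exists_eq_add_of_le hij
      exact hagree j d (j + d) hi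
  have hprefix : ∀ n, σ.IsPrefix X v π (s n).1.2 := fun n => (s n).2.congr (hπ n)
  have hn : ∀ n, n < (s (n + 1)).1.2 := fun n => hlen (n + 1)
  obtain ⟨τ, hτ⟩ := exists_adam_play_eq σ (π := π)
    (fun n => (hprefix (n + 1)).edge n (hn n)) (fun n => (hprefix (n + 1)).move n (hn n))
  refine ⟨τ, ?_⟩
  rw [← (hprefix 0).start, hτ]
  rintro ⟨N, K, hNK⟩
  -- This stretch starts after `K` and is longer than `N`.
  obtain ⟨k, h1, h2, h3⟩ := hgap (N + K) (s (N + K))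
  have := hlen (N + K)
  obtain ⟨k', hk1, hk2, hF⟩ := hNK k (by omega)
  refine h3 (k' - k) (by omega) ?_
  rw [show k + (k' - k) = k' by omega]
  have := hπ (N + K + 1) k' (by change _ ≤ (next (N + K) (s (N + K))).1.2; omega)
  rw [this] at hF
  exact hF

/-- Eve has a positional strategy that is winning from her whole winning set. -/
theorem exists_positional_eveWinsFrom (A : Arena V) (F : Set V) :
    ∃ σ : Strategy A .eve,
      σ.IsPositional ∧ σ.EveWinsFrom (A.eveWinningSet (A.finBuchi F)) (A.finBuchi F) := by
  classical
  obtain ⟨X, f, hf, hmax⟩ := exists_greatest_region A F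
  have hX : ∀ N Y, Y ⊆ A.attr (X ∪ (F ∩ A.cpre Y)) N → Y ⊆ X := by
    intro N Y hY
    obtain ⟨g, hg⟩ := hf.extend hY
    exact hY.trans (hmax _ g hg)
  let g : A.vertices .eve → V := fun v => if (v : V) ∈ X then f v else (A.noDeadEnd v).choose
  let σ : Strategy A .eve :=
    { next := fun _ v => g v
      legal := fun _ v => by
        simp only [g]
        split_ifs with h
        · exact (hf.eve v h v.2).1
        · exact (A.noDeadEnd v).choose_spec }
  refine ⟨σ, ⟨g, fun _ _ => rfl⟩, fun v₀ hv₀ τ => ?_⟩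
  have h0 : v₀ ∈ X := by
    by_contra h0
    obtain ⟨σ', hσ'⟩ := hv₀
    obtain ⟨τ', hτ'⟩ := σ'.exists_unbounded_play hX h0
    exact hτ' (mem_finBuchi_iff.mp (hσ' v₀ rfl τ')).2
  have hplay := play_mem_plays v₀ σ τ
  have hfol : ∀ n, play v₀ σ τ n ∈ X → A.owner (play v₀ σ τ n) = .eve →
      play v₀ σ τ (n + 1) = f (play v₀ σ τ n) := by
    intro n hn ho
    rw [play_succ, jointMove_eve _ _ _ ho]
    simp [σ, g, hn]
  have hmem : ∀ n, play v₀ σ τ n ∈ X := by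
    intro n
    induction n with
    | zero => exact h0
    | succ n ih => exact hf.step_mem ih (hplay n) (hfol n ih)
  exact mem_finBuchi_iff.mpr ⟨hplay, hf.gaps _ ⟨hplay, fun n => hfol n (hmem n)⟩ h0⟩

end Outside

/-! ### A pushdown arena in which Adam needs infinite memory -/

section Memory

/-- `run` recurses from the front, whereas a play grows at its end. -/
theorem MemoryStructure.run_append {V M : Type*} (𝓜 : MemoryStructure V M) (m : M) (w : List V)
    (u v : V) : 𝓜.run m (w ++ [u, v]) = 𝓜.update (𝓜.run m (w ++ [u])) (u, v) := by
  induction w generalizing m with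
  | nil => rfl
  | cons a w ih =>
    cases w with
    | nil => rfl
    | cons b w => exact ih (𝓜.update m (a, b))

/-- In the state `true` Adam may push, or change to the state `false`, in which the stack is
emptied before the state `true` is resumed. -/
def climbProcess : PushdownProcess Bool Unit where
  finiteStates := inferInstance
  finiteAlphabet := inferInstance
  Δ := {t | (∃ a, t = .push true a () true) ∨ (∃ a, t = .skip true a false) ∨
    t = .pop false () false ∨ t = .skip false none true}

theorem climbProcess_step_iff {c c' : Bool × List Unit} :
    climbProcess.Step c c' ↔
      (c.1 = true ∧ c' = (true, () :: c.2)) ∨ (c.1 = true ∧ c' = (false, c.2)) ∨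
      (c.1 = false ∧ c.2 ≠ [] ∧ c' = (false, c.2.tail)) ∨ (c = (false, []) ∧ c' = (true, [])) := by
  constructor
  · intro h
    cases h with
    | push h => simp_all [climbProcess]
    | pop h => simp_all [climbProcess]
    | skip h =>
      rename_i p q u
      rcases h with ⟨a, h⟩ | ⟨a, h⟩ | h | h <;> simp_all
  · rcases c with ⟨q, u⟩
    rintro (⟨h, rfl⟩ | ⟨h, rfl⟩ | ⟨h, hu, rfl⟩ | ⟨h, rfl⟩)
    · obtain rfl : q = true := h
      exact .push (Or.inl ⟨_, rfl⟩)
    · obtain rfl : q = true := h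
      exact .skip (Or.inr (Or.inl ⟨_, rfl⟩))
    · obtain rfl : q = false := h
      cases u with
      | nil => exact absurd rfl hu
      | cons a u => exact .pop (Or.inr (Or.inr (Or.inl rfl)))
    · cases h
      exact .skip (Or.inr (Or.inr (Or.inr rfl)))

theorem climbProcess_noDeadEnd (c : Bool × List Unit) : ∃ c', climbProcess.Step c c' := by
  rcases c with ⟨_ | _, _ | ⟨a, u⟩⟩ <;> simp [climbProcess_step_iff]

/-- The arena of `climbProcess`, in which all configurations belong to Adam. -/
abbrev climbArena : Arena (Bool × List Unit) :=
  climbProcess.arena (fun _ => .adam) climbProcess_noDeadEnd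

/-- The configurations with control state `true`. -/
abbrev climbTarget : Set (Bool × List Unit) := {c | c.1 ∈ ({true} : Set Bool)}

/-- Adam pushes as long as less than half of the elapsed time is the height of the stack. -/
noncomputable def climbStrategy : Strategy climbArena .adam where
  next w v := if v.1.1 = true then
      (if 2 * v.1.2.length < w.length then (true, () :: v.1.2) else (false, v.1.2))
    else (if v.1.2 = [] then (true, []) else (false, v.1.2.tail))
  legal w v := by
    obtain ⟨⟨q, u⟩, hv⟩ := v
    refine climbProcess_step_iff.mpr ?_
    cases q <;> cases u <;> dsimp only <;> split_ifs <;> simp_all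

theorem climbStrategy_play_succ (σ : Strategy climbArena .eve) (v : Bool × List Unit) (n : ℕ) :
    play v σ climbStrategy (n + 1) =
      if (play v σ climbStrategy n).1 = true then
        (if 2 * (play v σ climbStrategy n).2.length < n then
          (true, () :: (play v σ climbStrategy n).2) else (false, (play v σ climbStrategy n).2))
      else (if (play v σ climbStrategy n).2 = [] then (true, [])
        else (false, (play v σ climbStrategy n).2.tail)) := by
  rw [play_succ, jointMove_adam _ _ _ rfl]
  change (if _ then (if 2 * _ < ((List.range n).map _).length then _ else _) else _) = _
  rw [List.length_map, List.length_range]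

/-- From the empty stack at time `t`, Adam pushes while `2 * j < t + j`, so up to height `t` at time
`2 * t`. He then stays in the state `false` from `2 * t + 1` to `3 * t + 1` and is back at `(true,
[])` at `3 * t + 2`. -/
theorem climbStrategy_wins (σ : Strategy climbArena .eve) :
    ¬ BoundedGaps climbTarget (play (true, []) σ climbStrategy) := by
  set π := play (true, []) σ climbStrategy with hπ
  have hsucc : ∀ n, π (n + 1) = if (π n).1 = true then
        (if 2 * (π n).2.length < n then (true, () :: (π n).2) else (false, (π n).2))
      else (if (π n).2 = [] then (true, []) else (false, (π n).2.tail)) :=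
    climbStrategy_play_succ σ (true, [])
  have hup : ∀ t, π t = (true, []) → ∀ j ≤ t, π (t + j) = (true, List.replicate j ()) := by
    intro t ht j
    induction j with
    | zero => exact fun _ => ht
    | succ j ih =>
      intro hj
      rw [← Nat.add_assoc, hsucc, ih (by omega)]
      rw [if_pos rfl, if_pos (by simp; omega)]
      rfl
  have hdown : ∀ t, π t = (true, []) → ∀ j ≤ t,
      π (2 * t + 1 + j) = (false, List.replicate (t - j) ()) := by
    intro t ht j
    induction j with
    | zero =>
      intro _
      rw [Nat.add_zero, hsucc, show 2 * t = t + t by omega, hup t ht t le_rfl]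
      rw [if_pos rfl, if_neg (by simp; omega)]
      rfl
    | succ j ih =>
      intro hj
      rw [← Nat.add_assoc, hsucc, ih (by omega)]
      rw [if_neg (by simp), if_neg (by simp; omega)]
      simp [Nat.sub_sub]
  have hround : ∀ t, π t = (true, []) → π (3 * t + 2) = (true, []) := by
    intro t ht
    have := hdown t ht t le_rfl
    rw [show 2 * t + 1 + t = 3 * t + 1 by omega] at this
    rw [hsucc, this]
    simp
  have hinf : ∀ m, ∃ t, m ≤ t ∧ π t = (true, []) := by
    intro m
    induction m with
    | zero => exact ⟨0, le_rfl, rfl⟩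
    | succ m ih =>
      obtain ⟨t, h1, h2⟩ := ih
      exact ⟨3 * t + 2, by omega, hround t h2⟩
  rintro ⟨N, K, h⟩
  obtain ⟨t, h1, h2⟩ := hinf (N + K)
  obtain ⟨k, hk1, hk2, hk⟩ := h (2 * t + 1) (by omega)
  obtain ⟨j, rfl⟩ := Nat.exists_eq_add_of_le hk1
  have := hdown t h2 j (by omega)
  simp [this] at hk

theorem BoundedGaps.of_periodic {V : Type*} {F : Set V} {π : ℕ → V} {i p : ℕ} (hp : 0 < p)
    (hi : π i ∈ F) (hper : ∀ k, i ≤ k → π (k + p) = π k) : BoundedGaps F π := by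
  refine ⟨p, i, fun k hk => ?_⟩
  induction k, hk using Nat.le_induction with
  | base => exact ⟨i, le_rfl, by omega, hi⟩
  | succ k hk ih =>
    obtain ⟨k', h1, h2, h3⟩ := ih
    rcases Nat.lt_or_ge k k' with h | h
    · exact ⟨k', h, by omega, h3⟩
    · exact ⟨k' + p, by omega, by omega, by rwa [hper k' (by omega)]⟩

/-- From the state `false` the stack is emptied. -/
theorem climbArena_reaches_bottom {π : ℕ → Bool × List Unit} (hπ : π ∈ climbArena.plays) {k : ℕ}
    (hk : (π k).1 = false) : ∃ k', k ≤ k' ∧ π k' = (false, []) := by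
  obtain ⟨n, hn⟩ : ∃ n, (π k).2.length = n := ⟨_, rfl⟩
  induction n generalizing k with
  | zero => exact ⟨k, le_rfl, Prod.ext hk (List.length_eq_zero_iff.mp hn)⟩
  | succ n ih =>
    have hstep := climbProcess_step_iff.mp (hπ k)
    have hne : (π k).2 ≠ [] := fun h => by simp [h] at hn
    rcases hstep with ⟨h, -⟩ | ⟨h, -⟩ | ⟨-, -, h⟩ | ⟨h, -⟩
    · simp [hk] at h
    · simp [hk] at h
    · obtain ⟨k', h1, h2⟩ := ih (k := k + 1) (by rw [h]) (by rw [h]; simp [hn])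
      exact ⟨k', by omega, h2⟩
    · exact absurd (by rw [h]) hne

/-- If `(false, [])` recurs forever, some memory state repeats there; Adam makes all moves, so the
play becomes periodic. Otherwise the state `false`, which always leads to `(false, [])`, occurs only
finitely often. -/
theorem climbArena_finiteMemory_boundedGaps (σ : Strategy climbArena .eve)
    (τ : Strategy climbArena .adam) (hτ : τ.HasFiniteMemory) (v : Bool × List Unit) :
    BoundedGaps climbTarget (play v σ τ) := by
  obtain ⟨M, _, 𝓜, ν, hν⟩ := hτ
  set π := play v σ τ with hπdef
  have hπ : π ∈ climbArena.plays := play_mem_plays v σ τ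
  let mem : ℕ → M := fun n => 𝓜.run 𝓜.init ((List.range n).map π ++ [π n])
  have hmove : ∀ n, π (n + 1) = ν ⟨π n, rfl⟩ (mem n) := by
    intro n
    rw [hπdef, play_succ, jointMove_adam _ _ _ rfl, hν]
  have hmem : ∀ n, mem (n + 1) = 𝓜.update (mem n) (π n, π (n + 1)) := by
    intro n
    simp only [mem, List.range_succ, List.map_append, List.append_assoc]
    exact 𝓜.run_append _ _ _ _
  by_cases hinf : {n | π n = (false, [])}.Infinite
  · have := hinf.to_subtype
    obtain ⟨⟨i, hi⟩, ⟨j, hj⟩, hne, heq⟩ :=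
      Finite.exists_ne_map_eq_of_infinite fun n : {n | π n = (false, [])} => mem n
    have hne' : i ≠ j := fun h => hne (Subtype.ext h)
    clear hne
    wlog hij : i < j generalizing i j
    · exact this j hj i hi heq.symm hne'.symm (by omega)
    have hi' : π i = (false, []) := hi
    have hj' : π j = (false, []) := hj
    obtain ⟨p, rfl⟩ := Nat.exists_eq_add_of_le hij.le
    have hper : ∀ d, π (i + d + p) = π (i + d) ∧ mem (i + d + p) = mem (i + d) := by
      intro d
      induction d with
      | zero => exact ⟨hj'.trans hi'.symm, heq.symm⟩
      | succ d ih =>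
        have h1 : π (i + d + p + 1) = π (i + d + 1) := by
          rw [hmove, hmove, ih.2]
          congr 1
          exact Subtype.ext ih.1
        rw [show i + (d + 1) + p = i + d + p + 1 by omega, ← Nat.add_assoc]
        exact ⟨h1, by rw [hmem, hmem, h1, ih.1, ih.2]⟩
    -- The period starts outside the target, but the only move from `(false, [])` enters it.
    refine BoundedGaps.of_periodic (i := i + 1) (p := p) (by omega) ?_ fun k hk => ?_
    · have hstep := climbProcess_step_iff.mp (hπ i)
      rw [hi'] at hstep
      simp at hstep
      simp [hstep]
    · obtain ⟨d, rfl⟩ := Nat.exists_eq_add_of_le (show i ≤ k by omega)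
      exact (hper d).1
  · rw [Set.not_infinite] at hinf
    obtain ⟨K, hK⟩ := hinf.bddAbove
    refine ⟨0, K + 1, fun k hk => ⟨k, le_rfl, le_rfl, ?_⟩⟩
    by_contra hF
    obtain ⟨k', h1, h2⟩ := climbArena_reaches_bottom hπ (k := k) (by simpa using hF)
    have := hK h2
    omega

end Memory

end InfGame

theorem mainTheorem4 :
    (∀ (V : Type*) [Countable V] (A : InfGame.Arena V) (F : Set V),
      ∃ σ : InfGame.Strategy A .eve,
        σ.IsPositional ∧ σ.EveWinsFrom (A.eveWinningSet (A.finBuchi F)) (A.finBuchi F)) ∧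
    (∃ (Q Γ : Type) (S : InfGame.PushdownProcess Q Γ) (owner : Q → InfGame.Player)
      (h : ∀ c, ∃ c', S.Step c c') (F : Set Q) (v₀ : Q × List Γ),
      v₀ ∈ (S.arena owner h).adamWinningSet ((S.arena owner h).finBuchi {c | c.1 ∈ F}) ∧
      ∀ τ : InfGame.Strategy (S.arena owner h) .adam,
        τ.AdamWinsFrom {v₀} ((S.arena owner h).finBuchi {c | c.1 ∈ F}) →
          ¬ τ.HasFiniteMemory) := by
  refine ⟨fun V _ A F => InfGame.exists_positional_eveWinsFrom A F, Bool, Unit,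
    InfGame.climbProcess, fun _ => .adam, InfGame.climbProcess_noDeadEnd, {true}, (true, []),
    ⟨InfGame.climbStrategy, ?_⟩, fun τ hτ hfin => ?_⟩
  · rintro _ rfl σ
    exact ⟨InfGame.play_mem_plays _ _ _, fun h =>
      InfGame.climbStrategy_wins σ (InfGame.mem_finBuchi_iff.mp h).2⟩
  -- Eve owns no vertex, so any strategy of hers yields the play to be refuted.
  · obtain ⟨σ⟩ := InfGame.exists_strategy InfGame.climbArena .eve
    exact (hτ _ rfl σ).2 (InfGame.mem_finBuchi_iff.mpr ⟨InfGame.play_mem_plays _ _ _,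
      InfGame.climbArena_finiteMemory_boundedGaps σ τ hfin _⟩)
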